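/- Let $\mathcal B$ be a real or complex Banach space, not necessarily separable, and let $T$ be a linear automorphism of $\mathcal B$ (bounded, with bounded inverse). Call $T$ generalized hyperbolic if $\mathcal B = E^-\oplus E^+$ with complementary closed subspaces (either may be trivial) such that $T(E^+)\subset E^+$, $T^{-1}(E^-)\subset E^-$, and there are $C\ge 1$, $\lambda\in(0,1)$ with $|T^n v|\le C\lambda^n|v|$ for $v\in E^+$ and $|T^{-n}v|\le C\lambda^n|v|$ for $v\in E^-$, for all $n\ge 0$. Let $B(T)$ be the set of $x$ for which there is $K>0$ such that $|T^{k}x|<K$ for infinitely many positive integers $k$ and $|T^{-m}x|<K$ for infinitely many positive integers $m$. For $N>0$ let $B_N(T)=\{x: |T^nx|<N \ \forall n\in\mathbb Z\}$. Let $UB^{+}(T)=\{y:\lim_{n\to+\infty}|T^{n}y|=\infty\}$ and $UB^{-}(T)=\{y:\lim_{n\to+\infty}|T^{-n}y|=\infty\}$. Let $\Omega(T)$ be the set of $x$ such that for every neighbourhood $U$ of $x$ there is $k\ge 1$ with $T^k(U)\cap U\neq\emptyset$. Theorem. Let $T$ be generalized hyperbolic. Then: 1. $\overline{B(T)}$ is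 $T$-invariant and $T|_{\overline{B(T)}}$ is topologically mixing: for all nonempty relatively open $U,V\subset\overline{B(T)}$ there is $n_0$ such that $T^n(U)\cap V\ne\emptyset$ for all $n\ge n_0$. 2. The periodic points of $T$ form a dense subset of $B(T)$; $\Omega(T)=\overline{B(T)}$; and $\overline{B(T)}$ is a linear subspace. 3. $\overline{B(T)}=\overline{\bigcup_{N>0}B_N(T)}$. Moreover, for every $N>0$ for which $B_N(T)$ is separable (hence for every $N>0$ if $\mathcal B$ is separable) there exist $N'>N$ and $x\in B_{N'}(T)$ such that the closure of the orbit $\{T^nx:n\ge 0\}$ contains $B_N(T)$. 4. $T$ has the Lipschitz shadowing property: there is $K>0$ such that for every $\varepsilon>0$ there is $\delta>0$ with $\varepsilon<K\delta$ such that for every sequence $(x_n)_{n\in\mathbb Z}$ with $|x_{n+1}-Tx_n|<\delta$ for all $n\in\mathbb Z$ there is $y$ with $|x_n-T^ny|<\varepsilon$ for all $n\in\mathbb Z$. 5. If $E^+\ne\{0\}$ and $E^-\ne\{0\}$ for a splitting as above, then $UB^+(T)\cap UB^-(T)$ is dense in $\mathcal B$. -/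

import Mathlib

open Filter Topology Set

namespace GenHyp

section Definitions

variable {𝕜 : Type*} [RCLike 𝕜] {E : Type*} [NormedAddCommGroup E] [NormedSpace 𝕜 E]

/-- `E = Em ⊕ Ep` is a splitting into complementary closed subspaces with `T Ep ⊆ Ep`,
`T⁻¹ Em ⊆ Em`, such that `T` is uniformly contracting on `Ep` and `T⁻¹` is uniformly contracting
on `Em`. A constant `C` in front of the exponential is allowed; an adapted equivalent norm
makes it `1`. Either subspace may be trivial. -/
structure IsSplitting (T : E ≃L[𝕜] E) (Ep Em : Submodule 𝕜 E) : Prop where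
  closed_plus : IsClosed (Ep : Set E)
  closed_minus : IsClosed (Em : Set E)
  compl : IsCompl Em Ep
  map_plus : ∀ v ∈ Ep, T v ∈ Ep
  map_minus : ∀ v ∈ Em, T.symm v ∈ Em
  contract : ∃ C r : ℝ, 1 ≤ C ∧ 0 < r ∧ r < 1 ∧
    (∀ v ∈ Ep, ∀ n : ℕ, ‖(T ^ n : E ≃L[𝕜] E) v‖ ≤ C * r ^ n * ‖v‖) ∧
    (∀ v ∈ Em, ∀ n : ℕ, ‖(T.symm ^ n : E ≃L[𝕜] E) v‖ ≤ C * r ^ n * ‖v‖)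

/-- Generalized hyperbolic automorphisms. -/
def IsGeneralizedHyperbolic (T : E ≃L[𝕜] E) : Prop :=
  ∃ Ep Em : Submodule 𝕜 E, IsSplitting T Ep Em

/-- The bounded set `B(T)`: infinitely many forward and infinitely many backward iterates have
norm less than some constant `K`, which may depend on the point. -/
def boundedSet (T : E ≃L[𝕜] E) : Set E :=
  {x | ∃ K : ℝ, 0 < K ∧
    {k : ℕ | 0 < k ∧ ‖(T ^ k : E ≃L[𝕜] E) x‖ < K}.Infinite ∧
    {m : ℕ | 0 < m ∧ ‖(T.symm ^ m : E ≃L[𝕜] E) x‖ < K}.Infinite}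

/-- The set `B_N(T)` of points whose full orbit stays in the open ball of radius `N`. -/
def boundedSetN (T : E ≃L[𝕜] E) (N : ℝ) : Set E :=
  {x | ∀ n : ℤ, ‖(T ^ n : E ≃L[𝕜] E) x‖ < N}

/-- `UB⁺(T)`: points whose forward orbit tends to infinity in norm. -/
def unboundedPlus (T : E ≃L[𝕜] E) : Set E :=
  {y | Tendsto (fun n : ℕ => ‖(T ^ n : E ≃L[𝕜] E) y‖) atTop atTop}

/-- `UB⁻(T)`: points whose backward orbit tends to infinity in norm. -/
def unboundedMinus (T : E ≃L[𝕜] E) : Set E :=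
  {y | Tendsto (fun n : ℕ => ‖(T.symm ^ n : E ≃L[𝕜] E) y‖) atTop atTop}

/-- `L` is invariant under `T` and the restriction of `T` to `L` is topologically mixing, with
respect to the nonempty relatively open subsets of `L`. -/
def IsTopologicallyMixingOn (T : E ≃L[𝕜] E) (L : Set E) : Prop :=
  T '' L = L ∧ ∀ U V : Set E, IsOpen U → IsOpen V → (U ∩ L).Nonempty → (V ∩ L).Nonempty →
    ∃ n₀ : ℕ, ∀ n ≥ n₀, ((T ^ n : E ≃L[𝕜] E) '' (U ∩ L) ∩ (V ∩ L)).Nonempty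

/-- The set of periodic points. -/
def periodicSet (T : E ≃L[𝕜] E) : Set E :=
  {x | ∃ n : ℕ, 1 ≤ n ∧ (T ^ n : E ≃L[𝕜] E) x = x}

/-- The non-wandering set `Ω(T)`. -/
def nonwanderingSet (T : E ≃L[𝕜] E) : Set E :=
  {x | ∀ U ∈ 𝓝 x, ∃ k : ℕ, 1 ≤ k ∧ ((T ^ k : E ≃L[𝕜] E) '' U ∩ U).Nonempty}

/-- `δ`-pseudo-orbits, indexed by `ℤ`. -/
def IsPseudoOrbit (T : E ≃L[𝕜] E) (δ : ℝ) (x : ℤ → E) : Prop :=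
  ∀ n : ℤ, dist (x (n + 1)) (T (x n)) < δ

/-- The orbit of `y` `ε`-shadows the sequence `x`. -/
def Shadows (T : E ≃L[𝕜] E) (ε : ℝ) (y : E) (x : ℤ → E) : Prop :=
  ∀ n : ℤ, dist (x n) ((T ^ n : E ≃L[𝕜] E) y) < ε

/-- The Lipschitz shadowing property: every `ε` has a `δ` as in the shadowing property, which
can moreover be chosen with `ε < K δ` for a constant `K` independent of `ε`. -/
def HasLipschitzShadowing (T : E ≃L[𝕜] E) : Prop :=
  ∃ K : ℝ, 0 < K ∧ ∀ ε : ℝ, 0 < ε → ∃ δ : ℝ, 0 < δ ∧ ε < K * δ ∧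
    ∀ x : ℤ → E, IsPseudoOrbit T δ x → ∃ y : E, Shadows T ε y x

end Definitions

end GenHyp

/-! One tracing lemma, `exists_tracing`, carries everything but the unbounded orbits. For a sequence
`x` with bounded defects `d n = x (n + 1) - T (x n)`, subtract a bounded solution of `z (n + 1) = T
(z n) + d n`; the difference is a true orbit. Such a solution is explicit: push the `P`-parts of
past defects forward and pull the complementary parts of future defects back. Both series converge
geometrically, so the error at `n` is exponentially small in the distance to the nearest defect.

Shadowing is immediate. For recurrence the defects need only be bounded and far away: repeating an
orbit segment gives periodic points (`exists_closing`), switching once between two bounded orbits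
gives mixing, and concatenating long segments gives the dense orbit. Since periodic points are dense
in `boundedSet T`, its closure is that of the subspace `boundedOrbits T`.

Unbounded orbits come from a gliding hump: the norms of the powers of `T` and `T.symm` grow
exponentially, and tiny successive perturbations make all of them large at one point. -/

namespace GenHyp

/-! ### Integer powers and orbits. -/

section Iterates

variable {𝕜 : Type*} [RCLike 𝕜] {E : Type*} [NormedAddCommGroup E] [NormedSpace 𝕜 E]

@[simp]
theorem one_apply (x : E) : (1 : E ≃L[𝕜] E) x = x := rfl

theorem zpow_add_apply (T : E ≃L[𝕜] E) (m n : ℤ) (x : E) :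
    (T ^ (m + n) : E ≃L[𝕜] E) x = (T ^ m : E ≃L[𝕜] E) ((T ^ n : E ≃L[𝕜] E) x) := by
  rw [zpow_add]; rfl

theorem zpow_add_one_apply (T : E ≃L[𝕜] E) (n : ℤ) (x : E) :
    (T ^ (n + 1) : E ≃L[𝕜] E) x = T ((T ^ n : E ≃L[𝕜] E) x) := by
  rw [add_comm, zpow_add_apply, zpow_one]

theorem zpow_natCast_apply (T : E ≃L[𝕜] E) (n : ℕ) (x : E) :
    (T ^ (n : ℤ) : E ≃L[𝕜] E) x = (T ^ n : E ≃L[𝕜] E) x := by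
  rw [zpow_natCast]

theorem zpow_neg_natCast_apply (T : E ≃L[𝕜] E) (n : ℕ) (x : E) :
    (T ^ (-(n : ℤ)) : E ≃L[𝕜] E) x = (T.symm ^ n : E ≃L[𝕜] E) x := by
  rw [zpow_neg, zpow_natCast, ← inv_pow]; rfl

theorem pow_succ_apply (T : E ≃L[𝕜] E) (n : ℕ) (x : E) :
    (T ^ (n + 1) : E ≃L[𝕜] E) x = T ((T ^ n : E ≃L[𝕜] E) x) := by
  rw [pow_succ']; rfl

theorem apply_symm_pow_succ (T : E ≃L[𝕜] E) (n : ℕ) (x : E) :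
    T ((T.symm ^ (n + 1) : E ≃L[𝕜] E) x) = (T.symm ^ n : E ≃L[𝕜] E) x := by
  rw [pow_succ_apply, T.apply_symm_apply]

/-- An orbit of a sequence defined by the recursion `z (n + 1) = T (z n)` is an orbit of `T`. -/
theorem eq_zpow_of_recursion (T : E ≃L[𝕜] E) {z : ℤ → E} (hz : ∀ n, z (n + 1) = T (z n)) (n : ℤ) :
    z n = (T ^ n : E ≃L[𝕜] E) (z 0) := by
  induction n using Int.induction_on with
  | zero => simp
  | succ k ih => rw [hz, ih, zpow_add_one_apply]
  | pred k ih =>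
    apply T.injective
    rw [← hz, ← zpow_add_one_apply]
    simpa using ih

end Iterates

/-! ### The Green operator, tracing and shadowing. -/

section Green

variable {𝕜 : Type*} [RCLike 𝕜] {E : Type*} [NormedAddCommGroup E] [NormedSpace 𝕜 E]

/-- A bounded projection `P` along which `T` has an exponential dichotomy; the rate is written as
a square so that half of the decay can be traded for smallness. -/
def IsDichotomy (T : E ≃L[𝕜] E) (P : E →L[𝕜] E) (C s : ℝ) : Prop :=
  0 < C ∧ 0 < s ∧ s < 1 ∧ ∀ (x : E) (k : ℕ),
    ‖(T ^ k : E ≃L[𝕜] E) (P x)‖ ≤ C * s ^ k * s ^ k * ‖x‖ ∧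
    ‖(T.symm ^ k : E ≃L[𝕜] E) (x - P x)‖ ≤ C * s ^ k * s ^ k * ‖x‖

/-- Closedness of both summands makes the projection bounded; `‖P‖ + 1` bounds both `P` and its
complement, and `s = √r`. -/
theorem IsSplitting.exists_isDichotomy [CompleteSpace E] {T : E ≃L[𝕜] E} {Ep Em : Submodule 𝕜 E}
    (h : IsSplitting T Ep Em) : ∃ P C s, IsDichotomy T P C s := by
  obtain ⟨C, r, hC, hr0, hr1, hp, hm⟩ := h.contract
  have hc := Submodule.IsCompl.isTopCompl_of_isClosed h.compl.symm h.closed_plus h.closed_minus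
  let P : E →L[𝕜] E := Ep.projectionL Em hc
  have hPmem (x : E) : P x ∈ Ep := Submodule.projectionL_apply_mem hc x
  have hQmem (x : E) : x - P x ∈ Em := Submodule.sub_projection_mem hc.isCompl x
  have hs : √r * √r = r := Real.mul_self_sqrt hr0.le
  have hpow (k : ℕ) : √r ^ k * √r ^ k = r ^ k := by rw [← mul_pow, hs]
  have hPn : 0 ≤ ‖P‖ := norm_nonneg _
  refine ⟨P, C * (‖P‖ + 1), √r, by positivity, Real.sqrt_pos.2 hr0, ?_, fun x k => ⟨?_, ?_⟩⟩
  · rw [Real.sqrt_lt' one_pos]; simpa using hr1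
  · rw [mul_assoc (C * _), hpow]
    calc _ ≤ C * r ^ k * ‖P x‖ := hp _ (hPmem x) k
      _ ≤ C * r ^ k * ((‖P‖ + 1) * ‖x‖) := by
        gcongr
        nlinarith [P.le_opNorm x, norm_nonneg x]
      _ = _ := by ring
  · rw [mul_assoc (C * _), hpow]
    calc _ ≤ C * r ^ k * ‖x - P x‖ := hm _ (hQmem x) k
      _ ≤ C * r ^ k * ((‖P‖ + 1) * ‖x‖) := by
        gcongr
        nlinarith [P.le_opNorm x, norm_sub_le x (P x)]
      _ = _ := by ring

/-- The Green operator of a dichotomy: the bounded solution of `z (n + 1) = T (z n) + d n`. -/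
noncomputable def green (T : E ≃L[𝕜] E) (P : E →L[𝕜] E) (d : ℤ → E) (n : ℤ) : E :=
  (∑' k : ℕ, (T ^ k : E ≃L[𝕜] E) (P (d (n - 1 - k)))) -
    ∑' k : ℕ, (T.symm ^ (k + 1) : E ≃L[𝕜] E) (d (n + k) - P (d (n + k)))

variable {T : E ≃L[𝕜] E} {P : E →L[𝕜] E} {C s D : ℝ} {d : ℤ → E}

/-- If the first `L` vectors vanish, the `k`-th term is dominated by a small geometric series. -/
theorem IsDichotomy.norm_le_plus (h : IsDichotomy T P C s) {v : ℕ → E} (hD : ∀ k, ‖v k‖ ≤ D) {L : ℕ}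
    (hL : ∀ k < L, v k = 0) (k : ℕ) :
    ‖(T ^ k : E ≃L[𝕜] E) (P (v k))‖ ≤ C * D * s ^ L * s ^ k := by
  obtain ⟨hC, hs0, hs1, hb⟩ := h
  have hD0 : 0 ≤ D := (norm_nonneg _).trans (hD 0)
  rcases lt_or_ge k L with hk | hk
  · rw [hL k hk]; simp; positivity
  · calc _ ≤ C * s ^ k * s ^ k * ‖v k‖ := (hb _ k).1
      _ ≤ C * s ^ L * s ^ k * D := by
        gcongr C * ?_ * _ * ?_
        · exact pow_le_pow_of_le_one hs0.le hs1.le hk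
        · exact hD k
      _ = _ := by ring

theorem IsDichotomy.norm_le_minus (h : IsDichotomy T P C s) {v : ℕ → E} (hD : ∀ k, ‖v k‖ ≤ D)
    {L : ℕ} (hL : ∀ k < L, v k = 0) (k : ℕ) :
    ‖(T.symm ^ (k + 1) : E ≃L[𝕜] E) (v k - P (v k))‖ ≤ C * D * s ^ L * s ^ k := by
  obtain ⟨hC, hs0, hs1, hb⟩ := h
  have hD0 : 0 ≤ D := (norm_nonneg _).trans (hD 0)
  rcases lt_or_ge k L with hk | hk
  · rw [hL k hk]; simp; positivity
  · calc _ ≤ C * s ^ (k + 1) * s ^ (k + 1) * ‖v k‖ := (hb _ (k + 1)).2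
      _ ≤ C * s ^ L * s ^ k * D := by
        gcongr C * ?_ * ?_ * ?_
        · exact pow_le_pow_of_le_one hs0.le hs1.le (by omega)
        · exact pow_le_pow_of_le_one hs0.le hs1.le (by omega)
        · exact hD k
      _ = _ := by ring

/-- The two series see `d` at `n - 1 - k` and `n + k`, so the half-open window kills exactly the
first `L` terms of each. -/
theorem IsDichotomy.norm_green_le (h : IsDichotomy T P C s) (hD : ∀ n, ‖d n‖ ≤ D) {n : ℤ} {L : ℕ}
    (hL : ∀ j, n - L ≤ j → j < n + L → d j = 0) :
    ‖green T P d n‖ ≤ 2 * C / (1 - s) * D * s ^ L := by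
  have hsum : HasSum (fun k : ℕ => C * D * s ^ L * s ^ k) (C * D * s ^ L * (1 - s)⁻¹) :=
    (hasSum_geometric_of_lt_one h.2.1.le h.2.2.1).mul_left _
  refine (norm_sub_le _ _).trans ((add_le_add
    (tsum_of_norm_bounded hsum (h.norm_le_plus (v := fun k => d (n - 1 - k)) (fun _ => hD _) ?_))
    (tsum_of_norm_bounded hsum
      (h.norm_le_minus (v := fun k => d (n + k)) (fun _ => hD _) ?_))).trans_eq ?_)
  · intro k hk; apply hL <;> omega
  · intro k hk; apply hL <;> omega
  · ring

/-- Advancing by one step shifts both series; the boundary terms `P (d n)` and `d n - P (d n)` add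
up to `d n`. -/
theorem IsDichotomy.green_add_one [CompleteSpace E] (h : IsDichotomy T P C s)
    (hD : ∀ n, ‖d n‖ ≤ D) (n : ℤ) : green T P d (n + 1) = T (green T P d n) + d n := by
  have hgeo : Summable (fun k : ℕ => C * D * s ^ 0 * s ^ k) :=
    (summable_geometric_of_lt_one h.2.1.le h.2.2.1).mul_left _
  have hp (n : ℤ) : Summable fun k : ℕ => (T ^ k : E ≃L[𝕜] E) (P (d (n - 1 - k))) :=
    .of_norm_bounded hgeo
      (h.norm_le_plus (v := fun k => d (n - 1 - k)) (fun _ => hD _) (by simp))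
  have hm (n : ℤ) : Summable fun k : ℕ =>
      (T.symm ^ (k + 1) : E ≃L[𝕜] E) (d (n + k) - P (d (n + k))) :=
    .of_norm_bounded hgeo (h.norm_le_minus (v := fun k => d (n + k)) (fun _ => hD _) (by simp))
  have e1 : ∑' k : ℕ, (T ^ k : E ≃L[𝕜] E) (P (d (n + 1 - 1 - k))) =
      P (d n) + T (∑' k : ℕ, (T ^ k : E ≃L[𝕜] E) (P (d (n - 1 - k)))) := by
    rw [(hp (n + 1)).tsum_eq_zero_add, T.map_tsum]
    congr 1
    · simp
    · refine tsum_congr fun k => ?_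
      rw [pow_succ_apply]
      have : n + 1 - 1 - ((k + 1 : ℕ) : ℤ) = n - 1 - k := by push_cast; ring
      rw [this]
  have e2 : T (∑' k : ℕ, (T.symm ^ (k + 1) : E ≃L[𝕜] E) (d (n + k) - P (d (n + k)))) =
      (d n - P (d n)) + ∑' k : ℕ, (T.symm ^ (k + 1) : E ≃L[𝕜] E)
        (d (n + 1 + k) - P (d (n + 1 + k))) := by
    have hT := (T.summable (f := fun k : ℕ =>
      (T.symm ^ (k + 1) : E ≃L[𝕜] E) (d (n + k) - P (d (n + k))))).2 (hm n)
    rw [T.map_tsum, hT.tsum_eq_zero_add]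
    congr 1
    · rw [apply_symm_pow_succ]; simp
    · refine tsum_congr fun k => ?_
      rw [apply_symm_pow_succ]
      have : n + ((k + 1 : ℕ) : ℤ) = n + 1 + k := by push_cast; ring
      rw [this]
  rw [green, green, map_sub, e1, e2]
  abel

/-- Bounded solutions need not be unique, so periodicity is read off the translation-invariant
formula. -/
theorem green_add_period {p : ℤ} (hd : ∀ n, d (n + p) = d n) (n : ℤ) :
    green T P d (n + p) = green T P d n := by
  have h1 (k : ℕ) : d (n + p - 1 - k) = d (n - 1 - k) := by rw [← hd (n - 1 - k)]; congr 1; ring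
  have h2 (k : ℕ) : d (n + p + k) = d (n + k) := by rw [← hd (n + k)]; congr 1; ring
  simp only [green, h1, h2]

/-- Every sequence with bounded one-step defects is traced by an orbit; the tracing error is
exponentially small in the length of the defect-free window, and a periodic sequence is traced by
a periodic orbit. -/
theorem IsGeneralizedHyperbolic.exists_tracing [CompleteSpace E] (hT : IsGeneralizedHyperbolic T) :
    ∃ M s : ℝ, 0 < M ∧ 0 < s ∧ s < 1 ∧ ∀ (D : ℝ) (x : ℤ → E), (∀ n, ‖x (n + 1) - T (x n)‖ ≤ D) →
      ∃ y : E, (∀ n, ‖x n - (T ^ n : E ≃L[𝕜] E) y‖ ≤ M * D) ∧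
        (∀ (n : ℤ) (L : ℕ), (∀ j, n - L ≤ j → j < n + L → x (j + 1) = T (x j)) →
          ‖x n - (T ^ n : E ≃L[𝕜] E) y‖ ≤ M * D * s ^ L) ∧
        ∀ p : ℤ, (∀ n, x (n + p) = x n) → (T ^ p : E ≃L[𝕜] E) y = y := by
  obtain ⟨Ep, Em, h⟩ := hT
  obtain ⟨P, C, s, h⟩ := h.exists_isDichotomy
  have hs : 0 < 1 - s := sub_pos.2 h.2.2.1
  have hC := h.1
  refine ⟨2 * C / (1 - s), s, by positivity, h.2.1, h.2.2.1, fun D x hD => ?_⟩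
  let d : ℤ → E := fun n => x (n + 1) - T (x n)
  let w : ℤ → E := fun n => x n - green T P d n
  have hw (n : ℤ) : w (n + 1) = T (w n) := by
    simp only [w, h.green_add_one (d := d) hD, map_sub]
    simp only [d]; abel
  have hxw (n : ℤ) : x n - (T ^ n : E ≃L[𝕜] E) (w 0) = green T P d n := by
    rw [← eq_zpow_of_recursion T hw n]; simp [w]
  have key (n : ℤ) (L : ℕ) (hL : ∀ j, n - L ≤ j → j < n + L → x (j + 1) = T (x j)) :
      ‖x n - (T ^ n : E ≃L[𝕜] E) (w 0)‖ ≤ 2 * C / (1 - s) * D * s ^ L := by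
    rw [hxw]
    exact h.norm_green_le hD fun j h1 h2 => sub_eq_zero.2 (hL j h1 h2)
  refine ⟨w 0, fun n => ?_, key, fun p hp => ?_⟩
  · simpa using key n 0 (by intro j h1 h2; simp at h1 h2; omega)
  · have hd (n : ℤ) : d (n + p) = d n := by
      simp only [d, hp]
      rw [show n + p + 1 = n + 1 + p by ring, hp]
    rw [← eq_zpow_of_recursion T hw p]
    simp only [w]
    rw [← zero_add p, hp, green_add_period hd]

theorem IsGeneralizedHyperbolic.hasLipschitzShadowing [CompleteSpace E]
    (hT : IsGeneralizedHyperbolic T) : HasLipschitzShadowing T := by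
  obtain ⟨M, s, hM, -, -, h⟩ := hT.exists_tracing
  -- `M + 1` makes `M * δ < ε` strict, and `M + 2` makes `ε < K * δ` strict.
  refine ⟨M + 2, by positivity, fun ε hε => ⟨ε / (M + 1), by positivity, ?_, fun x hx => ?_⟩⟩
  · rw [mul_div_assoc', lt_div_iff₀ (by positivity)]; nlinarith
  · obtain ⟨y, hy, -, -⟩ := h (ε / (M + 1)) x fun n => by
      rw [← dist_eq_norm]; exact (hx n).le
    refine ⟨y, fun n => ?_⟩
    rw [dist_eq_norm]
    refine (hy n).trans_lt ?_
    rw [mul_div_assoc', div_lt_iff₀ (by positivity)]; nlinarith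

end Green

/-! ### Periodic points, non-wandering set, mixing and dense orbits. -/

section Recurrence

variable {𝕜 : Type*} [RCLike 𝕜] {E : Type*} [NormedAddCommGroup E] [NormedSpace 𝕜 E]
  {T : E ≃L[𝕜] E}

/-- The subspace of points with bounded full orbit. -/
def boundedOrbits (T : E ≃L[𝕜] E) : Submodule 𝕜 E where
  carrier := {x | ∃ N : ℝ, ∀ n : ℤ, ‖(T ^ n : E ≃L[𝕜] E) x‖ ≤ N}
  zero_mem' := ⟨0, fun n => by simp⟩
  add_mem' := by
    rintro x y ⟨N, hN⟩ ⟨N', hN'⟩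
    refine ⟨N + N', fun n => ?_⟩
    rw [map_add]
    exact (norm_add_le _ _).trans (add_le_add (hN n) (hN' n))
  smul_mem' := by
    rintro c x ⟨N, hN⟩
    refine ⟨‖c‖ * N, fun n => ?_⟩
    rw [map_smul, norm_smul]
    exact mul_le_mul_of_nonneg_left (hN n) (norm_nonneg c)

theorem mem_boundedOrbits {x : E} :
    x ∈ boundedOrbits T ↔ ∃ N : ℝ, ∀ n : ℤ, ‖(T ^ n : E ≃L[𝕜] E) x‖ ≤ N := Iff.rfl

theorem zpow_mem_boundedOrbits {x : E} (hx : x ∈ boundedOrbits T) (m : ℤ) :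
    (T ^ m : E ≃L[𝕜] E) x ∈ boundedOrbits T := by
  obtain ⟨N, hN⟩ := hx
  exact ⟨N, fun n => by rw [← zpow_add_apply]; exact hN _⟩

theorem iUnion_boundedSetN (T : E ≃L[𝕜] E) :
    ⋃ N ∈ Ioi (0 : ℝ), boundedSetN T N = boundedOrbits T := by
  ext x
  simp only [mem_iUnion, SetLike.mem_coe, mem_boundedOrbits, exists_prop, mem_Ioi]
  constructor
  · rintro ⟨N, -, h⟩
    exact ⟨N, fun n => (h n).le⟩
  · rintro ⟨N, h⟩
    have hN : 0 ≤ N := (norm_nonneg _).trans (h 0)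
    exact ⟨N + 1, by linarith, fun n => (h n).trans_lt (by linarith)⟩

theorem boundedOrbits_subset_boundedSet (T : E ≃L[𝕜] E) :
    (boundedOrbits T : Set E) ⊆ boundedSet T := by
  rintro x ⟨N, h⟩
  have hN : 0 ≤ N := (norm_nonneg _).trans (h 0)
  refine ⟨N + 1, by linarith, (Set.Ioi_infinite 0).mono fun k hk => ⟨hk, ?_⟩,
    (Set.Ioi_infinite 0).mono fun k hk => ⟨hk, ?_⟩⟩
  · rw [← zpow_natCast_apply]; linarith [h k]
  · rw [← zpow_neg_natCast_apply]; linarith [h (-k)]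

theorem zpow_mul_apply_of_fixed {x : E} {p : ℤ} (h : (T ^ p : E ≃L[𝕜] E) x = x) (k : ℤ) :
    (T ^ (p * k) : E ≃L[𝕜] E) x = x := by
  rw [zpow_mul]
  exact (eq_zpow_of_recursion (T ^ p) (z := fun _ => x) (fun _ => h.symm) k).symm

theorem periodicSet_subset_boundedOrbits (T : E ≃L[𝕜] E) :
    periodicSet T ⊆ boundedOrbits T := by
  rintro x ⟨p, hp, hx⟩
  rw [← zpow_natCast_apply] at hx
  have hp' : (0 : ℤ) < p := by exact_mod_cast hp
  refine ⟨∑ j ∈ Finset.range p, ‖(T ^ j : E ≃L[𝕜] E) x‖, fun n => ?_⟩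
  have h0 := Int.emod_nonneg n hp'.ne'
  have h1 := Int.emod_lt_of_pos n hp'
  have : (T ^ n : E ≃L[𝕜] E) x = (T ^ (n % p).toNat : E ≃L[𝕜] E) x := by
    rw [← zpow_natCast_apply, Int.toNat_of_nonneg h0]
    conv_lhs => rw [← Int.emod_add_mul_ediv n p, zpow_add_apply, zpow_mul_apply_of_fixed hx]
  rw [this]
  exact Finset.single_le_sum (f := fun j => ‖(T ^ j : E ≃L[𝕜] E) x‖) (fun _ _ => norm_nonneg _)
    (Finset.mem_range.2 (by omega))

theorem exists_mul_pow_lt {s : ℝ} (hs0 : 0 < s) (hs1 : s < 1) (a : ℝ) {ε : ℝ} (hε : 0 < ε) :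
    ∃ L : ℕ, a * s ^ L < ε := by
  have := (tendsto_pow_atTop_nhds_zero_of_lt_one hs0.le hs1).const_mul a
  rw [mul_zero] at this
  exact (this.eventually_lt_const hε).exists

/-- Closing lemma: an orbit segment whose end returns within `D` of its start is followed by a
periodic orbit, exponentially closely in the middle of the segment. -/
theorem IsGeneralizedHyperbolic.exists_closing [CompleteSpace E] (hT : IsGeneralizedHyperbolic T) :
    ∃ M s : ℝ, 0 < M ∧ 0 < s ∧ s < 1 ∧ ∀ (D : ℝ) (u : E) (p : ℕ),
      ‖(T ^ p : E ≃L[𝕜] E) u - u‖ ≤ D → ∃ y : E, (T ^ p : E ≃L[𝕜] E) y = y ∧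
        ∀ m L : ℕ, L ≤ m → m + L < p →
          ‖(T ^ m : E ≃L[𝕜] E) u - (T ^ m : E ≃L[𝕜] E) y‖ ≤ M * D * s ^ L := by
  obtain ⟨M, s, hM, hs0, hs1, h⟩ := hT.exists_tracing
  refine ⟨M, s, hM, hs0, hs1, fun D u p hu => ?_⟩
  rcases Nat.eq_zero_or_pos p with rfl | hp
  · exact ⟨u, by simp, fun m L _ h => by omega⟩
  have hp' : (0 : ℤ) < p := by exact_mod_cast hp
  -- The segment `u, …, T ^ (p - 1) u` repeated periodically; its only possible defect per period,
  -- at `n % p = p - 1`, is the return error of `u`.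
  let x : ℤ → E := fun n => (T ^ (n % p) : E ≃L[𝕜] E) u
  have hstep (n : ℤ) (hn : n % p + 1 < p) : x (n + 1) = T (x n) := by
    simp only [x]
    rw [← zpow_add_one_apply, Int.add_emod, Int.emod_eq_of_lt (a := n % p + 1 % p)]
    · congr 3
      exact Int.emod_eq_of_lt (by omega) (by have := Int.emod_nonneg n hp'.ne'; omega)
    · exact add_nonneg (Int.emod_nonneg _ hp'.ne') (Int.emod_nonneg _ hp'.ne')
    · rw [Int.emod_eq_of_lt (a := 1) (by omega)
        (by have := Int.emod_nonneg n hp'.ne'; omega)]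
      exact hn
  have hdef (n : ℤ) : ‖x (n + 1) - T (x n)‖ ≤ D := by
    by_cases hn : n % p + 1 < p
    · rw [hstep n hn, sub_self, norm_zero]
      exact (norm_nonneg _).trans hu
    · have h1 : n % p + 1 = p := by have := Int.emod_lt_of_pos n hp'; omega
      have h2 : (n + 1) % p = 0 := by
        rw [← Int.emod_add_mul_ediv n p, add_right_comm, h1, Int.add_mul_emod_self_left,
          Int.emod_self]
      simp only [x]
      rw [← zpow_add_one_apply, h1, h2, zpow_zero, one_apply, zpow_natCast_apply, norm_sub_rev]
      exact hu
  obtain ⟨y, -, hy, hper⟩ := h D x hdef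
  refine ⟨y, ?_, fun m L hLm hLp => ?_⟩
  · rw [← zpow_natCast_apply]
    exact hper p fun n => by simp [x]
  · have := hy m L fun j h1 h2 => hstep j (by
      rw [Int.emod_eq_of_lt (by omega) (by omega)]; omega)
    simp only [x] at this
    rwa [Int.emod_eq_of_lt (by omega) (by omega), zpow_natCast_apply, zpow_natCast_apply] at this

/-- The orbit segment from time `-m` to time `k` around `x` has both ends of norm below `K`. The
closing gap `2K` is not small, but it does not depend on the length, so late return times on both
sides make the error at `x` small. -/
theorem IsGeneralizedHyperbolic.boundedSet_subset_closure_periodicSet [CompleteSpace E]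
    (hT : IsGeneralizedHyperbolic T) : boundedSet T ⊆ closure (periodicSet T) := by
  obtain ⟨M, s, hM, hs0, hs1, h⟩ := hT.exists_closing
  rintro x ⟨K, hK, hf, hb⟩
  rw [Metric.mem_closure_iff]
  intro ε hε
  obtain ⟨L, hL⟩ := exists_mul_pow_lt hs0 hs1 (M * (K + K)) hε
  obtain ⟨k, ⟨-, hk⟩, hkL⟩ := hf.exists_gt L
  obtain ⟨m, ⟨-, hm⟩, hmL⟩ := hb.exists_gt L
  set u := (T.symm ^ m : E ≃L[𝕜] E) x with hu
  have hux : (T ^ m : E ≃L[𝕜] E) u = x := by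
    rw [hu, ← zpow_natCast_apply, ← zpow_neg_natCast_apply, ← zpow_add_apply]; simp
  have huk : (T ^ (k + m) : E ≃L[𝕜] E) u = (T ^ k : E ≃L[𝕜] E) x := by
    rw [← hux, pow_add]; rfl
  obtain ⟨y, hy, hyu⟩ := h (K + K) u (k + m) (by
    rw [huk]; exact (norm_sub_le _ _).trans (add_le_add hk.le hm.le))
  refine ⟨(T ^ m : E ≃L[𝕜] E) y, ⟨k + m, by omega, ?_⟩, ?_⟩
  · rw [← zpow_natCast_apply, ← zpow_natCast_apply, ← zpow_add_apply, add_comm, zpow_add_apply,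
      zpow_natCast_apply T (k + m), hy]
  · have := hyu m L hmL.le (by omega)
    rw [hux] at this
    rw [dist_eq_norm]
    exact this.trans_lt hL

theorem IsGeneralizedHyperbolic.closure_periodicSet [CompleteSpace E]
    (hT : IsGeneralizedHyperbolic T) : closure (periodicSet T) = closure (boundedSet T) :=
  (closure_mono ((periodicSet_subset_boundedOrbits T).trans
    (boundedOrbits_subset_boundedSet T))).antisymm
    (closure_minimal hT.boundedSet_subset_closure_periodicSet isClosed_closure)

/-- The subspace lies between the periodic points and `boundedSet T`, whose closures agree. -/
theorem IsGeneralizedHyperbolic.closure_boundedOrbits [CompleteSpace E]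
    (hT : IsGeneralizedHyperbolic T) :
    closure (boundedOrbits T : Set E) = closure (boundedSet T) :=
  (closure_mono (boundedOrbits_subset_boundedSet T)).antisymm
    (hT.closure_periodicSet ▸ closure_mono (periodicSet_subset_boundedOrbits T))

theorem IsGeneralizedHyperbolic.nonwanderingSet_eq [CompleteSpace E]
    (hT : IsGeneralizedHyperbolic T) : nonwanderingSet T = closure (boundedSet T) := by
  rw [← hT.closure_periodicSet]
  obtain ⟨M, s, hM, hs0, hs1, h⟩ := hT.exists_closing
  ext x
  constructor
  · intro hx
    rw [Metric.mem_closure_iff]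
    intro ε hε
    -- Chosen so that `η + M * (2 * η) = ε`: the point `u` is `η`-close to `x`, and its return gap
    -- is at most `2 * η`.
    have hη : 0 < ε / (1 + M * 2) := by positivity
    set η := ε / (1 + M * 2) with hη_def
    obtain ⟨k, hk, -, ⟨u, hu, rfl⟩, hku⟩ := hx _ (Metric.ball_mem_nhds x hη)
    rw [Metric.mem_ball] at hu hku
    obtain ⟨y, hy, hyu⟩ := h (η + η) u k (by
      rw [← dist_eq_norm]
      exact (dist_triangle_right _ _ x).trans (add_le_add hku.le hu.le))
    refine ⟨y, ⟨k, hk, hy⟩, ?_⟩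
    have h0 := hyu 0 0 le_rfl (by omega)
    simp only [pow_zero, one_apply, mul_one] at h0
    rw [← dist_eq_norm] at h0
    calc dist x y ≤ dist x u + dist u y := dist_triangle _ _ _
      _ < η + M * (η + η) := add_lt_add_of_lt_of_le (by rwa [dist_comm]) h0
      _ = ε := by rw [hη_def]; field_simp; ring
  · intro hx U hU
    obtain ⟨y, hyU, k, hk, hy⟩ := mem_closure_iff_nhds.1 hx U hU
    exact ⟨k, hk, y, ⟨y, hyU, hy⟩, hyU⟩

theorem IsGeneralizedHyperbolic.isTopologicallyMixingOn [CompleteSpace E]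
    (hT : IsGeneralizedHyperbolic T) : IsTopologicallyMixingOn T (closure (boundedSet T)) := by
  rw [← hT.closure_boundedOrbits]
  constructor
  · rw [T.image_closure]
    congr 1
    ext x
    constructor
    · rintro ⟨y, hy, rfl⟩
      simpa using zpow_mem_boundedOrbits hy 1
    · intro hx
      refine ⟨T.symm x, ?_, T.apply_symm_apply x⟩
      have := zpow_mem_boundedOrbits hx (-1)
      rwa [zpow_neg_one] at this
  · rintro U V hU hV ⟨x', hxU', hx'⟩ ⟨y', hyV', hy'⟩
    obtain ⟨x, hxU, Dx, hDx⟩ := mem_closure_iff.1 hx' U hU hxU'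
    obtain ⟨y, hyV, Dy, hDy⟩ := mem_closure_iff.1 hy' V hV hyV'
    obtain ⟨εx, hεx, hUx⟩ := Metric.isOpen_iff.1 hU x hxU
    obtain ⟨εy, hεy, hVy⟩ := Metric.isOpen_iff.1 hV y hyV
    obtain ⟨M, s, hM, hs0, hs1, h⟩ := hT.exists_tracing
    have hDx0 : 0 ≤ Dx := (norm_nonneg _).trans (hDx 0)
    have hDy0 : 0 ≤ Dy := (norm_nonneg _).trans (hDy 0)
    obtain ⟨L, hL⟩ := exists_mul_pow_lt hs0 hs1 (M * (Dy + Dx)) (lt_min hεx hεy)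
    refine ⟨2 * L + 1, fun n hn => ?_⟩
    -- Follow the orbit of `x` until time `L`, then the orbit of `y` timed to be at `y` at time `n`.
    -- The single jump, at `j = L`, is bounded independently of `n`, and `n ≥ 2 * L + 1` keeps it
    -- out of the windows around `0` and `n`.
    let z : ℤ → E := fun j => if j ≤ L then (T ^ j : E ≃L[𝕜] E) x else (T ^ (j - n) : E ≃L[𝕜] E) y
    have hstep (j : ℤ) (hj : j ≠ L) : z (j + 1) = T (z j) := by
      rcases lt_or_gt_of_ne hj with hj | hj
      · simp only [z]
        rw [if_pos (by omega), if_pos hj.le, zpow_add_one_apply]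
      · simp only [z]
        rw [if_neg (by omega), if_neg (by omega), ← zpow_add_one_apply]
        congr 2; ring
    have hdef (j : ℤ) : ‖z (j + 1) - T (z j)‖ ≤ Dy + Dx := by
      by_cases hj : j = L
      · simp only [z]
        rw [if_neg (by omega), if_pos (by omega), ← zpow_add_one_apply]
        exact (norm_sub_le _ _).trans (add_le_add (hDy _) (hDx _))
      · rw [hstep j hj, sub_self, norm_zero]; positivity
    obtain ⟨w, hw, hwL, -⟩ := h _ z hdef
    have hz (j : ℤ) : ‖z j‖ ≤ Dx + Dy := by
      simp only [z]
      split_ifs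
      · linarith [hDx j]
      · linarith [hDy (j - n)]
    have hwB : w ∈ boundedOrbits T :=
      ⟨Dx + Dy + M * (Dy + Dx), fun j => (norm_le_norm_add_norm_sub (z j) _).trans
        (add_le_add (hz j) (hw j))⟩
    have h0 := hwL 0 L fun j h1 h2 => hstep j (by omega)
    have h1 := hwL n L fun j h1 h2 => hstep j (by omega)
    simp only [z] at h0 h1
    rw [if_pos (by omega), zpow_zero, one_apply, one_apply, ← dist_eq_norm, dist_comm] at h0
    rw [if_neg (by omega), sub_self, zpow_zero, one_apply, ← dist_eq_norm, dist_comm] at h1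
    refine ⟨(T ^ n : E ≃L[𝕜] E) w, ⟨w, ⟨hUx ?_, subset_closure hwB⟩, rfl⟩, hVy ?_, subset_closure ?_⟩
    · exact h0.trans_lt (hL.trans_le (min_le_left _ _))
    · rw [← zpow_natCast_apply]
      exact h1.trans_lt (hL.trans_le (min_le_right _ _))
    · rw [← zpow_natCast_apply]
      exact zpow_mem_boundedOrbits hwB n

/-- A single bounded orbit is dense in any separable set of uniformly bounded orbits. -/
theorem IsGeneralizedHyperbolic.exists_dense_orbit [CompleteSpace E]
    (hT : IsGeneralizedHyperbolic T) {N : ℝ} (hN : 0 < N)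
    (hsep : TopologicalSpace.IsSeparable (boundedSetN T N)) :
    ∃ N' : ℝ, N < N' ∧ ∃ x ∈ boundedSetN T N',
      boundedSetN T N ⊆ closure (range fun n : ℕ => (T ^ n : E ≃L[𝕜] E) x) := by
  obtain ⟨M, s, hM, hs0, hs1, h⟩ := hT.exists_tracing
  obtain ⟨t, htN, htc, htd⟩ := hsep.exists_countable_dense_subset
  have hne : t.Nonempty := by
    rw [← closure_nonempty_iff]
    exact ⟨0, htd fun n => by simpa using hN⟩
  obtain ⟨q, rfl⟩ := htc.exists_eq_range hne
  have hq (i : ℕ) (n : ℤ) : ‖(T ^ n : E ≃L[𝕜] E) (q i)‖ < N := htN ⟨i, rfl⟩ n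
  -- Block `i` is `[i², i² + 2i]` with centre `i² + i`, where `z` passes through `q (unpair i).1`.
  -- Pairing makes each `q a` the centre of arbitrarily long blocks. Negative times join block `0`,
  -- since `toNat` sends them to `0`.
  let r : ℤ → ℕ := fun n => Nat.sqrt n.toNat
  let z : ℤ → E := fun n => (T ^ (n - (r n ^ 2 + r n : ℕ)) : E ≃L[𝕜] E) (q (r n).unpair.1)
  have hz (n : ℤ) : ‖z n‖ < N := hq _ _
  have hr (i : ℕ) (n : ℤ) (h1 : (i ^ 2 : ℕ) ≤ n) (h2 : n ≤ (i ^ 2 + i + i : ℕ)) : r n = i := by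
    have h3 : i ^ 2 + i + i < (i + 1) ^ 2 := by ring_nf; omega
    exact le_antisymm (Nat.lt_succ_iff.1 (Nat.sqrt_lt'.2 (by rw [Nat.succ_eq_add_one]; omega)))
      (Nat.le_sqrt'.2 (by omega))
  have hdef (n : ℤ) : ‖z (n + 1) - T (z n)‖ ≤ N + N := by
    have hTz : ‖T (z n)‖ < N := by
      simp only [z]
      rw [← zpow_add_one_apply]
      exact hq _ _
    exact (norm_sub_le _ _).trans (add_le_add (hz _).le hTz.le)
  obtain ⟨y, hy, hyL, -⟩ := h _ z hdef
  refine ⟨N + M * (N + N), lt_add_of_pos_right _ (by positivity), y, fun n => ?_, ?_⟩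
  · exact (norm_le_norm_add_norm_sub (z n) _).trans_lt (add_lt_add_of_lt_of_le (hz n) (hy n))
  refine htd.trans (closure_minimal ?_ isClosed_closure)
  rintro - ⟨a, rfl⟩
  rw [Metric.mem_closure_range_iff]
  intro ε hε
  obtain ⟨L, hL⟩ := exists_mul_pow_lt hs0 hs1 (M * (N + N)) hε
  set i := Nat.pair a L with hi
  have hiL : L ≤ i := Nat.right_le_pair a L
  have hc : z (i ^ 2 + i : ℕ) = q a := by
    simp only [z]
    rw [hr i _ (by push_cast; omega) (by push_cast; omega), sub_self, zpow_zero, one_apply, hi,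
      Nat.unpair_pair]
  have := hyL (i ^ 2 + i : ℕ) L fun j h1 h2 => by
    simp only [z]
    rw [hr i j (by push_cast at *; omega) (by push_cast at *; omega),
      hr i (j + 1) (by push_cast at *; omega) (by push_cast at *; omega), ← zpow_add_one_apply]
    congr 2; ring
  refine ⟨i ^ 2 + i, ?_⟩
  rw [hc, zpow_natCast_apply] at this
  rw [dist_eq_norm]
  exact this.trans_lt hL

end Recurrence

/-! ### Density of points with orbits unbounded in both directions. -/

section Unbounded

variable {𝕜 : Type*} [RCLike 𝕜] {E : Type*} [NormedAddCommGroup E] [NormedSpace 𝕜 E]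

/-- If the norms of a sequence of operators grow fast enough, then the points at which the whole
sequence tends to infinity are dense. -/
theorem dense_tendsto_norm_atTop [CompleteSpace E] {F : Type*} [NormedAddCommGroup F]
    [NormedSpace 𝕜 F] (A : ℕ → E →L[𝕜] F) {c : ℝ} (hc : 0 < c) (hA : ∀ n, c * 10 ^ n ≤ ‖A n‖) :
    Dense {y | Tendsto (fun n => ‖A n y‖) atTop atTop} := by
  intro v
  rw [Metric.mem_closure_iff]
  intro ε hε
  have hApos (n : ℕ) : 0 < ‖A n‖ := lt_of_lt_of_le (by positivity) (hA n)
  have hunit (n : ℕ) : ∃ u : E, ‖u‖ < 1 ∧ ‖A n‖ / 2 < ‖A n u‖ :=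
    (A n).exists_lt_apply_of_lt_opNorm (half_lt_self (hApos n))
  choose u hu1 hu2 using hunit
  -- Ratio `1 / 9` shrinks slower than `10 ^ n` grows, yet all moves after the `n`-th total at most
  -- `a n / 8`. They cost at most half of the lower bound `a n * ‖A n‖ / 4` secured at step `n`.
  let a : ℕ → ℝ := fun n => ε / 2 * (1 / 9) ^ n
  have ha (n : ℕ) : 0 < a n := by positivity
  have hnext (n : ℕ) (x : E) : ∃ x', dist x x' ≤ ε / 2 * (1 / 9) ^ n ∧
      a n * ‖A n‖ / 4 ≤ ‖A n x'‖ := by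
    -- If `‖A n x‖` is small, moving by `a n • u n` adds a vector whose image exceeds `a n * ‖A n‖ /
    -- 2`, of which `A n x` cancels at most half.
    by_cases hx : a n * ‖A n‖ / 4 ≤ ‖A n x‖
    · exact ⟨x, by rw [dist_self]; positivity, hx⟩
    · refine ⟨x + (a n : 𝕜) • u n, ?_, ?_⟩
      · rw [dist_self_add_right, norm_smul, RCLike.norm_ofReal, abs_of_pos (ha n)]
        exact mul_le_of_le_one_right (ha n).le (hu1 n).le
      · rw [map_add, map_smul]
        have h1 := norm_sub_le (A n x + (a n : 𝕜) • A n (u n)) (A n x)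
        rw [add_sub_cancel_left, norm_smul, RCLike.norm_ofReal, abs_of_pos (ha n)] at h1
        nlinarith [mul_lt_mul_of_pos_left (hu2 n) (ha n)]
  choose f hf1 hf2 using hnext
  let w : ℕ → E := fun n => Nat.rec v f n
  have hw (n : ℕ) : dist (w n) (w (n + 1)) ≤ ε / 2 * (1 / 9) ^ n := hf1 n (w n)
  obtain ⟨y, hy⟩ := cauchySeq_tendsto_of_complete
    (cauchySeq_of_le_geometric (1 / 9) (ε / 2) (by norm_num) hw)
  have hd (n : ℕ) := dist_le_of_le_geometric_of_tendsto (1 / 9) (ε / 2) (by norm_num) hw hy n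
  refine ⟨y, ?_, ?_⟩
  · have hlow (n : ℕ) : c * ε / 16 * (10 / 9) ^ n ≤ ‖A n y‖ := by
      have h1 : a n * ‖A n‖ / 4 ≤ ‖A n (w (n + 1))‖ := hf2 n (w n)
      have h2 : ‖A n (w (n + 1)) - A n y‖ ≤ ‖A n‖ * (a n / 8) := by
        rw [← map_sub]
        refine (A n).le_opNorm_of_le ?_
        rw [← dist_eq_norm]
        refine (hd (n + 1)).trans_eq ?_
        simp only [a]; ring
      have h3 := norm_sub_norm_le (A n (w (n + 1))) (A n y)
      calc c * ε / 16 * (10 / 9) ^ n = a n * (c * 10 ^ n) / 8 := by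
            simp only [a, div_pow]; field_simp; ring
        _ ≤ a n * ‖A n‖ / 8 := by gcongr; exact hA n
        _ ≤ _ := by linarith
    exact tendsto_atTop_mono hlow ((tendsto_pow_atTop_atTop_of_one_lt (by norm_num)).const_mul_atTop
      (by positivity))
  · have := hd 0
    change dist v y ≤ _ at this
    refine this.trans_lt ?_
    norm_num
    linarith

/-- Divergence along a subsequence of bounded gaps forces divergence of the whole orbit. -/
theorem tendsto_norm_pow_of_tendsto_mul (S : E ≃L[𝕜] E) {m : ℕ} (hm : 0 < m) {y : E}
    (h : Tendsto (fun k : ℕ => ‖(S ^ (m * k) : E ≃L[𝕜] E) y‖) atTop atTop) :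
    Tendsto (fun n : ℕ => ‖(S ^ n : E ≃L[𝕜] E) y‖) atTop atTop := by
  -- `K` dominates the norms of `S.symm ^ i` for `i < m`, which lead from time `n` back to the
  -- preceding multiple of `m`.
  let K : ℝ := 1 + ∑ i ∈ Finset.range m, ‖((S.symm ^ i : E ≃L[𝕜] E) : E →L[𝕜] E)‖
  have hK : 0 < K := by positivity
  have hdiv : Tendsto (fun n : ℕ => n / m) atTop atTop := Nat.tendsto_div_const_atTop hm.ne'
  refine tendsto_atTop_mono (fun n => ?_) ((h.comp hdiv).const_mul_atTop (inv_pos.2 hK))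
  rw [inv_mul_le_iff₀ hK]
  have hn : (S ^ (m * (n / m)) : E ≃L[𝕜] E) y =
      (S.symm ^ (n % m) : E ≃L[𝕜] E) ((S ^ n : E ≃L[𝕜] E) y) := by
    rw [← zpow_neg_natCast_apply, ← zpow_natCast_apply, ← zpow_natCast_apply, ← zpow_add_apply]
    congr 2
    have : ((n % m + m * (n / m) : ℕ) : ℤ) = n := by rw [Nat.mod_add_div]
    push_cast at this ⊢
    linarith
  simp only [Function.comp_apply, hn]
  refine (((S.symm ^ (n % m) : E ≃L[𝕜] E) : E →L[𝕜] E).le_opNorm _).trans ?_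
  gcongr
  have := Finset.single_le_sum (f := fun i => ‖((S.symm ^ i : E ≃L[𝕜] E) : E →L[𝕜] E)‖)
    (fun _ _ => norm_nonneg _) (Finset.mem_range.2 (Nat.mod_lt n hm))
  simp only [K]
  linarith

/-- If the inverse contracts some nonzero vector exponentially, the norms of the powers grow. -/
theorem le_norm_pow_of_symm_contracts {S : E ≃L[𝕜] E} {C r : ℝ} (hC : 0 < C) (hr : 0 < r) {v : E}
    (hv : v ≠ 0) (h : ∀ n : ℕ, ‖(S.symm ^ n : E ≃L[𝕜] E) v‖ ≤ C * r ^ n * ‖v‖) (n : ℕ) :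
    C⁻¹ * r⁻¹ ^ n ≤ ‖((S ^ n : E ≃L[𝕜] E) : E →L[𝕜] E)‖ := by
  have h1 : (S ^ n : E ≃L[𝕜] E) ((S.symm ^ n : E ≃L[𝕜] E) v) = v := by
    rw [← zpow_neg_natCast_apply, ← zpow_natCast_apply, ← zpow_add_apply, add_neg_cancel,
      zpow_zero, one_apply]
  have h2 := ((S ^ n : E ≃L[𝕜] E) : E →L[𝕜] E).le_opNorm_of_le (h n)
  rw [ContinuousLinearEquiv.coe_coe, h1, ← mul_assoc] at h2
  have h3 := le_of_mul_le_mul_right ((one_mul _).trans_le h2) (norm_pos_iff.2 hv)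
  rw [inv_pow, ← mul_inv, inv_le_iff_one_le_mul₀ (by positivity)]
  exact h3

/-- A nonzero vector of `Em` forces growth of `‖T ^ n‖`, one of `Ep` growth of `‖T.symm ^ n‖`.
Interleaving both families into one sequence `A` yields divergence in both directions at the same
point. -/
theorem IsSplitting.dense_unbounded [CompleteSpace E] {T : E ≃L[𝕜] E} {Ep Em : Submodule 𝕜 E}
    (h : IsSplitting T Ep Em) (hp : Ep ≠ ⊥) (hm : Em ≠ ⊥) :
    Dense (unboundedPlus T ∩ unboundedMinus T) := by
  obtain ⟨C, r, hC, hr0, hr1, hcp, hcm⟩ := h.contract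
  obtain ⟨x, hx, hx0⟩ := Submodule.exists_mem_ne_zero_of_ne_bot hm
  obtain ⟨z, hz, hz0⟩ := Submodule.exists_mem_ne_zero_of_ne_bot hp
  have hC0 : 0 < C := by linarith
  have gp := le_norm_pow_of_symm_contracts (S := T) hC0 hr0 hx0 (hcm x hx)
  have gm := le_norm_pow_of_symm_contracts (S := T.symm) hC0 hr0 hz0 (hcp z hz)
  -- Each `k` occupies two indices of `A`, so growth `10` per index needs `100` per `k`; the odd
  -- index is absorbed by the factor `C⁻¹ / 10`.
  obtain ⟨m, hm⟩ := pow_unbounded_of_one_lt 100 ((one_lt_inv₀ hr0).2 hr1)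
  have hm0 : 0 < m := by
    rcases Nat.eq_zero_or_pos m with rfl | h
    · norm_num at hm
    · exact h
  have hgrow (k : ℕ) : C⁻¹ * 100 ^ k ≤ C⁻¹ * r⁻¹ ^ (m * k) := by
    rw [pow_mul]; gcongr
  let A : ℕ → E →L[𝕜] E := fun n =>
    if Even n then ((T ^ (m * (n / 2)) : E ≃L[𝕜] E) : E →L[𝕜] E)
    else ((T.symm ^ (m * (n / 2)) : E ≃L[𝕜] E) : E →L[𝕜] E)
  have hAe (k : ℕ) : A (2 * k) = ((T ^ (m * k) : E ≃L[𝕜] E) : E →L[𝕜] E) := by simp [A]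
  have hAo (k : ℕ) : A (2 * k + 1) = ((T.symm ^ (m * k) : E ≃L[𝕜] E) : E →L[𝕜] E) := by
    simp only [A]
    rw [if_neg (by simp), show (2 * k + 1) / 2 = k by omega]
  have hpow (k : ℕ) : (10 : ℝ) ^ (2 * k) = 100 ^ k := by rw [pow_mul]; norm_num
  have hA (n : ℕ) : C⁻¹ / 10 * 10 ^ n ≤ ‖A n‖ := by
    obtain ⟨k, rfl | rfl⟩ := n.even_or_odd'
    · rw [hAe, hpow]
      refine le_trans ?_ ((hgrow k).trans (gp _))
      have : 0 < C⁻¹ * 100 ^ k := by positivity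
      linarith
    · rw [hAo, pow_succ, hpow]
      refine le_trans (le_of_eq ?_) ((hgrow k).trans (gm _))
      ring
  refine (dense_tendsto_norm_atTop A (by positivity) hA).mono fun y hy => ?_
  have he : Tendsto (fun k : ℕ => 2 * k) atTop atTop :=
    tendsto_atTop_mono (fun k => (by omega : k ≤ 2 * k)) tendsto_id
  have ho : Tendsto (fun k : ℕ => 2 * k + 1) atTop atTop := (tendsto_add_atTop_nat 1).comp he
  constructor
  · refine tendsto_norm_pow_of_tendsto_mul T hm0 ((hy.comp he).congr fun k => ?_)
    simp [hAe]
  · refine tendsto_norm_pow_of_tendsto_mul T.symm hm0 ((hy.comp ho).congr fun k => ?_)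
    simp [hAo]

end Unbounded

end GenHyp

theorem theorem1 {𝕜 : Type*} [RCLike 𝕜] {E : Type*} [NormedAddCommGroup E] [NormedSpace 𝕜 E]
    [CompleteSpace E] (T : E ≃L[𝕜] E) (hT : GenHyp.IsGeneralizedHyperbolic T) :
    -- mixing on the closure of the bounded set
    GenHyp.IsTopologicallyMixingOn T (closure (GenHyp.boundedSet T)) ∧
    -- periodic points, non-wandering set, subspace
    (GenHyp.periodicSet T ⊆ GenHyp.boundedSet T ∧
      GenHyp.boundedSet T ⊆ closure (GenHyp.periodicSet T) ∧
      GenHyp.nonwanderingSet T = closure (GenHyp.boundedSet T) ∧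
      ∃ S : Submodule 𝕜 E, (S : Set E) = closure (GenHyp.boundedSet T)) ∧
    -- uniformly bounded orbits
    (closure (GenHyp.boundedSet T) = closure (⋃ N ∈ Set.Ioi (0 : ℝ), GenHyp.boundedSetN T N) ∧
      ∀ N : ℝ, 0 < N → TopologicalSpace.IsSeparable (GenHyp.boundedSetN T N) →
        ∃ N' : ℝ, N < N' ∧ ∃ x ∈ GenHyp.boundedSetN T N',
          GenHyp.boundedSetN T N ⊆ closure (Set.range fun n : ℕ => (T ^ n : E ≃L[𝕜] E) x)) ∧
    -- Lipschitz shadowing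
    GenHyp.HasLipschitzShadowing T ∧
    -- points with unbounded orbits, when both subspaces of a splitting are nontrivial
    (∀ Ep Em : Submodule 𝕜 E, GenHyp.IsSplitting T Ep Em → Ep ≠ ⊥ → Em ≠ ⊥ →
      Dense (GenHyp.unboundedPlus T ∩ GenHyp.unboundedMinus T)) := by
  refine ⟨hT.isTopologicallyMixingOn, ⟨?_, hT.boundedSet_subset_closure_periodicSet,
    hT.nonwanderingSet_eq, (GenHyp.boundedOrbits T).topologicalClosure, ?_⟩, ⟨?_, ?_⟩,
    hT.hasLipschitzShadowing, fun Ep Em h hp hm => h.dense_unbounded hp hm⟩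
  · exact (GenHyp.periodicSet_subset_boundedOrbits T).trans
      (GenHyp.boundedOrbits_subset_boundedSet T)
  · rw [Submodule.topologicalClosure_coe, hT.closure_boundedOrbits]
  · rw [GenHyp.iUnion_boundedSetN, hT.closure_boundedOrbits]
  · exact fun N hN hsep => hT.exists_dense_orbit hN hsep
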